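/- Let $\mathcal{E}=(E,\ast)$ be a finite biordered set, i.e. $E$ is the set of idempotents of a semigroup $S$ (not necessarily finite), $E$ is finite, and $\ast$ is the partial operation with $e\ast f=ef$ defined exactly when $\{e,f\}$ is a basic pair, meaning $\{e,f\}\cap\{ef,fe\}\neq\varnothing$. Let $IG(\mathcal{E})=\langle\,\overline{E} : \overline{e}\,\overline{f}=\overline{e\ast f}\text{ whenever }\{e,f\}\text{ is a basic pair}\,\rangle$ be the free idempotent generated semigroup over $\mathcal{E}$, and for a word $w$ in the free semigroup $E^+$ let $\overline{w}$ be the element of $IG(\mathcal{E})$ that it represents. An r-factorisation of $w\in E^+$ is a factorisation $w=w_1\cdots w_m$ into words $w_i\in E^+$ such that every $\overline{w_i}$ is a regular element of $IG(\mathcal{E})$; it is minimal if it is minimal among the r-factorisations of $w$ in the order in which a factorisation lies below another one if its factors are products of consecutive blocks of factors of the other. Let $\mathscr{R},\mathscr{L}$ be Green's relations on $IG(\mathcal{E})$ and $\mathscr{D}=\mathscr{R}\vee\mathscr{L}$. Let $u,v\in E^+$ be such that $\overline{u}=\overline{v}$, and let $u=p_1\cdots p_m$ and $v=q_1\cdots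 q_s$ be arbitrary minimal r-factorisations. Then $m=s$ and $\overline{p_i}\,\mathscr{D}\,\overline{q_i}$ for all $1\leq i\leq m$. Furthermore, $\overline{p_1}\,\mathscr{R}\,\overline{q_1}$ and $\overline{p_m}\,\mathscr{L}\,\overline{q_m}$. Consequently, for every $x\in IG(\mathcal{E})$ there is exactly one sequence of $\mathscr{D}$-classes of $IG(\mathcal{E})$ (the $\mathscr{D}$-fingerprint of $x$) that equals $(D_{\overline{p_1}},\dots,D_{\overline{p_m}})$ for every word $w\in E^+$ with $\overline{w}=x$ and every minimal r-factorisation $w=p_1\cdots p_m$. -/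

import Mathlib

section Green

variable {T : Type*} [Semigroup T]

/-- The principal right ideal `a T¹ = {a} ∪ a T`. -/
def principalRight (a : T) : Set T := {x | x = a ∨ ∃ t : T, x = a * t}

/-- The principal left ideal `T¹ a = {a} ∪ T a`. -/
def principalLeft (a : T) : Set T := {x | x = a ∨ ∃ t : T, x = t * a}

/-- Green's relation `ℛ`: `a ℛ b` iff `a T¹ = b T¹`. -/
def greenR (T : Type*) [Semigroup T] : Setoid T := Setoid.ker principalRight

/-- Green's relation `ℒ`: `a ℒ b` iff `T¹ a = T¹ b`. -/
def greenL (T : Type*) [Semigroup T] : Setoid T := Setoid.ker principalLeft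

/-- Green's relation `𝒟`, the least equivalence containing both `ℛ` and `ℒ`. -/
def greenD (T : Type*) [Semigroup T] : Setoid T := greenR T ⊔ greenL T

/-- `a` is a regular element of the semigroup `T`. -/
def IsRegularElem (a : T) : Prop := ∃ b : T, a * b * a = a

end Green

section Biordered

/-- The set `E` of idempotents of a semigroup `S`. -/
abbrev Idempotents (S : Type*) [Semigroup S] : Type _ := {e : S // IsIdempotentElem e}

variable {S : Type*} [Semigroup S]

/-- `{e, f}` is a basic pair: `{e, f} ∩ {ef, fe} ≠ ∅`. -/
def BasicPair (e f : Idempotents S) : Prop :=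
  (({(e : S), (f : S)} : Set S) ∩ {(e : S) * f, (f : S) * e}).Nonempty

theorem BasicPair.isIdempotentElem_mul {e f : Idempotents S} (h : BasicPair e f) :
    IsIdempotentElem ((e : S) * f) := by
  obtain ⟨e, he⟩ := e
  obtain ⟨f, hf⟩ := f
  simp only [IsIdempotentElem] at he hf ⊢
  obtain ⟨x, hx, hx'⟩ := h
  simp only [Set.mem_insert_iff, Set.mem_singleton_iff] at hx hx'
  rcases hx with rfl | rfl <;> rcases hx' with h | h
  · rw [← h, he]
  · rw [mul_assoc, ← mul_assoc f, ← h, ← mul_assoc, he]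
  · rw [← h, hf]
  · rw [mul_assoc, ← mul_assoc x, ← h, hf]

/-- The partial product `e ∗ f` of the biordered set of `S`, defined exactly on basic pairs, where
it is the product `ef` of `S`. The idempotents of `S` with this partial operation form the
biordered set of `S`. -/
def BasicPair.star {e f : Idempotents S} (h : BasicPair e f) : Idempotents S :=
  ⟨(e : S) * f, h.isIdempotentElem_mul⟩

/-- The defining relations `ē f̄ = (e ∗ f)‾`, for `{e, f}` a basic pair. -/
inductive IGRel (S : Type*) [Semigroup S] :
    FreeSemigroup (Idempotents S) → FreeSemigroup (Idempotents S) → Prop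
  | basic (e f : Idempotents S) (h : BasicPair e f) :
      IGRel S (FreeSemigroup.of e * FreeSemigroup.of f) (FreeSemigroup.of h.star)

/-- The free idempotent generated semigroup `IG(ℰ)` over the biordered set `ℰ` of `S`: the
quotient of the free semigroup `E⁺` by the congruence generated by the defining relations. -/
def IG (S : Type*) [Semigroup S] : Type _ := (conGen (IGRel S)).Quotient

instance (S : Type*) [Semigroup S] : Semigroup (IG S) :=
  inferInstanceAs (Semigroup (conGen (IGRel S)).Quotient)

/-- The natural homomorphism `w ↦ w̄` from `E⁺` to `IG(ℰ)`. -/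
def IG.bar : FreeSemigroup (Idempotents S) →ₙ* IG S where
  toFun w := ((w : (conGen (IGRel S)).Quotient) : IG S)
  map_mul' _ _ := rfl

end Biordered

section Factorisations

/-- The nonempty list of letters of a word of the free semigroup. -/
def FreeSemigroup.letters {A : Type*} (w : FreeSemigroup A) : List A := w.head :: w.tail

/-- `w = p₁ ⋯ pₘ`, for a sequence `(p₁, …, pₘ)` of nonempty words (so `1 ≤ m`, as `w` is
nonempty). -/
def IsFactorisation {A : Type*} (w : FreeSemigroup A) (p : List (FreeSemigroup A)) : Prop :=
  (p.map FreeSemigroup.letters).flatten = w.letters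

/-- `p ≼ q`: the sequence `p` is coarser than `q`, i.e. `q` can be cut into consecutive nonempty
blocks whose products are, in order, the members of `p`. -/
def Coarser {A : Type*} (p q : List (FreeSemigroup A)) : Prop :=
  ∃ blocks : List (List (FreeSemigroup A)),
    blocks.flatten = q ∧ List.Forall₂ IsFactorisation p blocks

variable {S : Type*} [Semigroup S]

/-- `p` is an r-factorisation of `w`: every factor represents a regular element of `IG(ℰ)`. -/
def IsRFactorisation (w : FreeSemigroup (Idempotents S))
    (p : List (FreeSemigroup (Idempotents S))) : Prop :=
  IsFactorisation w p ∧ ∀ x ∈ p, IsRegularElem (IG.bar x)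

/-- `p` is a minimal r-factorisation of `w`: minimal for `≼` among the r-factorisations of `w`. -/
def IsMinimalRFactorisation (w : FreeSemigroup (Idempotents S))
    (p : List (FreeSemigroup (Idempotents S))) : Prop :=
  IsRFactorisation w p ∧ ∀ q, IsRFactorisation w q → Coarser q p → q = p

theorem IsMinimalRFactorisation.ne_nil {w : FreeSemigroup (Idempotents S)}
    {p : List (FreeSemigroup (Idempotents S))} (h : IsMinimalRFactorisation w p) : p ≠ [] := by
  rintro rfl
  have h1 : IsFactorisation w [] := h.1.1
  simp [IsFactorisation, FreeSemigroup.letters] at h1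

/-- The sequence of the `𝒟`-classes, in `IG(ℰ)`, of the elements represented by the members
of `p`. -/
def dClasses (p : List (FreeSemigroup (Idempotents S))) : List (Quotient (greenD (IG S))) :=
  p.map fun x => Quotient.mk (greenD (IG S)) (IG.bar x)

end Factorisations

/-!
Let `x = t₁ ⋯ tₙ` with letters `tᵢ`. A letter `t = tᵢ` is a *seed* when `z t ℒ t ℛ t y`, for `z` and
`y` the products of the letters before and after it; as `t` is idempotent, `x = z t y` is then
regular. Whether `x` contributes a seed to `z x y` is described by a derivation, and each defining
relation `ē f̄ = (e ∗ f)‾` respects it because `ē f̄ ē = ē` or `f̄ ē f̄ = f̄` for a basic pair. So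
having a seed is a property of the element of `IG(ℰ)`, not of the word, and `x y` has a seed iff `x`
has one and `x ℛ x y`, or `y` has one and `y ℒ x y`.

This splitting rule makes the merging of adjacent factors confluent up to shifts
`(x, y) ↦ (x', y')` with `x ℛ x'`, `y ℒ y'` and `x y = x' y'`, which preserve the `𝒟`-class of every
factor, the `ℛ`-class of the first and the `ℒ`-class of the last one. It remains to see that every
regular element has a seed, for which idempotents suffice. If `w` represents an idempotent, then
shortest factorisations of `w` and `w w` into factors with seeds have the same length, and cutting
the one of `w w` in the middle gives a seed in the idempotent.
-/

section Green

variable {T : Type*} [Semigroup T] {a b c x y : T}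

theorem mem_principalRight : b ∈ principalRight a ↔ (a : WithOne T) ∣ b := by
  simp only [principalRight, Set.mem_ofPred_eq, dvd_def, WithOne.exists, mul_one, WithOne.coe_inj]
  norm_cast

theorem mem_principalLeft : b ∈ principalLeft a ↔ ∃ c : WithOne T, (b : WithOne T) = c * a := by
  simp only [principalLeft, Set.mem_ofPred_eq, WithOne.exists, one_mul, WithOne.coe_inj]
  norm_cast

theorem greenR_iff : greenR T a b ↔ (a : WithOne T) ∣ b ∧ (b : WithOne T) ∣ a := by
  refine ⟨fun h => ?_, fun ⟨hab, hba⟩ => Set.ext fun x => ?_⟩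
  · have h : principalRight a = principalRight b := h
    rw [← mem_principalRight, ← mem_principalRight, h, ← h]
    exact ⟨h ▸ Or.inl rfl, Or.inl rfl⟩
  · rw [mem_principalRight, mem_principalRight]
    exact ⟨hba.trans, hab.trans⟩

theorem greenL_iff : greenL T a b ↔
    (∃ c : WithOne T, (b : WithOne T) = c * a) ∧ ∃ c : WithOne T, (a : WithOne T) = c * b := by
  refine ⟨fun h => ?_, fun ⟨⟨c, hc⟩, ⟨d, hd⟩⟩ => Set.ext fun x => ?_⟩
  · have h : principalLeft a = principalLeft b := h
    rw [← mem_principalLeft, ← mem_principalLeft, h, ← h]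
    exact ⟨h ▸ Or.inl rfl, Or.inl rfl⟩
  · rw [mem_principalLeft, mem_principalLeft]
    constructor <;> rintro ⟨e, he⟩
    · exact ⟨e * d, by rw [he, mul_assoc, ← hd]⟩
    · exact ⟨e * c, by rw [he, mul_assoc, ← hc]⟩

theorem greenR_mul_left (c : T) (h : greenR T a b) : greenR T (c * a) (c * b) := by
  simp only [greenR_iff, WithOne.coe_mul] at h ⊢
  exact h.imp (mul_dvd_mul_left _) (mul_dvd_mul_left _)

theorem greenL_mul_right (c : T) (h : greenL T a b) : greenL T (a * c) (b * c) := by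
  simp only [greenL_iff, WithOne.coe_mul] at h ⊢
  exact h.imp (fun ⟨d, hd⟩ => ⟨d, by rw [hd, mul_assoc]⟩)
    fun ⟨d, hd⟩ => ⟨d, by rw [hd, mul_assoc]⟩

theorem greenR_mul_iff : greenR T x (x * y) ↔ (x * y : WithOne T) ∣ x := by
  rw [greenR_iff, WithOne.coe_mul]
  exact and_iff_right (dvd_mul_right _ _)

theorem greenL_mul_iff : greenL T y (x * y) ↔ ∃ c : WithOne T, (y : WithOne T) = c * (x * y) := by
  rw [greenL_iff, WithOne.coe_mul]
  exact and_iff_right ⟨x, rfl⟩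

theorem greenR_mul_of_greenR_mul_mul (h : greenR T x (x * (a * b))) : greenR T x (x * a) := by
  rw [greenR_mul_iff, WithOne.coe_mul, ← mul_assoc] at h
  exact greenR_mul_iff.2 ((dvd_mul_right _ _).trans h)

theorem greenL_mul_of_greenL_mul_mul (h : greenL T x (a * b * x)) : greenL T x (b * x) := by
  rw [greenL_mul_iff, WithOne.coe_mul] at h
  obtain ⟨c, hc⟩ := h
  exact greenL_mul_iff.2 ⟨c * a, by rwa [mul_assoc, ← mul_assoc (a : WithOne T)]⟩

theorem isRegularElem_iff_exists_withOne :
    IsRegularElem a ↔ ∃ b : WithOne T, (a * b * a : WithOne T) = a := by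
  rw [WithOne.exists, mul_one]
  norm_cast
  refine ⟨Or.inr, Or.rec (fun h => ⟨a, ?_⟩) id⟩
  rw [h, h]

theorem IsRegularElem.of_greenR (ha : IsRegularElem a) (h : greenR T a b) : IsRegularElem b := by
  obtain ⟨c, hc⟩ := isRegularElem_iff_exists_withOne.1 ha
  obtain ⟨⟨s, hs⟩, ⟨t, ht⟩⟩ := greenR_iff.1 h
  refine isRegularElem_iff_exists_withOne.2 ⟨t * c, ?_⟩
  calc (b * (t * c) * b : WithOne T) = b * t * c * a * s := by simp only [hs, mul_assoc]
    _ = b := by rw [← ht, hc, ← hs]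

theorem IsRegularElem.of_greenL (ha : IsRegularElem a) (h : greenL T a b) : IsRegularElem b := by
  obtain ⟨c, hc⟩ := isRegularElem_iff_exists_withOne.1 ha
  obtain ⟨⟨s, hs⟩, ⟨t, ht⟩⟩ := greenL_iff.1 h
  refine isRegularElem_iff_exists_withOne.2 ⟨c * t, ?_⟩
  calc (b * (c * t) * b : WithOne T) = s * (a * c * (t * b)) := by simp only [hs, mul_assoc]
    _ = b := by rw [← ht, hc, ← hs]

end Green

section RewritingModulo

open Relation

variable {α : Type*} {r E : α → α → Prop} {a b c m n : α}

/-- `n` is a normal form of `a` for the rewriting relation `r`: it is reached from `a` and cannot be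
rewritten any further. -/
def IsNormalForm (r : α → α → Prop) (a n : α) : Prop := ReflTransGen r a n ∧ ∀ c, ¬ r n c

theorem IsNormalForm.head (h : r a b) (hn : IsNormalForm r b n) : IsNormalForm r a n :=
  ⟨hn.1.head h, hn.2⟩

theorem exists_isNormalForm (hwf : WellFounded (flip r)) (a : α) : ∃ n, IsNormalForm r a n := by
  induction a using hwf.induction with
  | _ a ih =>
    by_cases h : ∃ b, r a b
    · obtain ⟨b, hb⟩ := h
      obtain ⟨n, hn⟩ := ih b hb
      exact ⟨n, hn.head hb⟩
    · exact ⟨a, .refl, not_exists.1 h⟩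

theorem IsNormalForm.equiv (hwf : WellFounded (flip r)) (hE : Equivalence E)
    (hsim : ∀ {a b a'}, E a b → r a a' → ∃ b', r b b' ∧ E a' b')
    (hconf : ∀ {a b c}, r a b → r a c → E b c ∨ ∃ d, r b d ∧ r c d) (hab : E a b)
    (han : IsNormalForm r a n) (hbm : IsNormalForm r b m) : E n m := by
  induction a using hwf.induction generalizing b n m with
  | _ a ih =>
    rcases han.1.cases_head with rfl | ⟨a₁, ha₁, ha₁n⟩
    · rcases hbm.1.cases_head with rfl | ⟨b₂, hb₂, -⟩
      · exact hab
      · obtain ⟨c, hc, -⟩ := hsim (hE.symm hab) hb₂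
        exact absurd hc (han.2 c)
    obtain ⟨b₁, hb₁, hab₁⟩ := hsim hab ha₁
    rcases hbm.1.cases_head with rfl | ⟨b₂, hb₂, hb₂m⟩
    · exact absurd hb₁ (hbm.2 b₁)
    have ih₁ {b k} (h : E a₁ b) (hk : IsNormalForm r b k) : E n k := ih a₁ ha₁ h ⟨ha₁n, han.2⟩ hk
    rcases hconf hb₁ hb₂ with hb | ⟨d, hd₁, hd₂⟩
    · exact ih₁ (hE.trans hab₁ hb) ⟨hb₂m, hbm.2⟩
    · obtain ⟨a₂, ha₂, hab₂⟩ := hsim (hE.symm hab) hb₂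
      obtain ⟨k, hk⟩ := exists_isNormalForm hwf d
      obtain ⟨l, hl⟩ := exists_isNormalForm hwf a₂
      have hnk : E n k := ih₁ hab₁ (hk.head hd₁)
      have hlk : E l k := ih a₂ ha₂ (hE.symm hab₂) hl (hk.head hd₂)
      have hlm : E l m := ih a₂ ha₂ (hE.symm hab₂) hl ⟨hb₂m, hbm.2⟩
      exact hE.trans hnk (hE.trans (hE.symm hlk) hlm)

theorem IsNormalForm.equiv_of_eqvGen (hwf : WellFounded (flip r)) (hE : Equivalence E)
    (hsim : ∀ {a b a'}, E a b → r a a' → ∃ b', r b b' ∧ E a' b')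
    (hconf : ∀ {a b c}, r a b → r a c → E b c ∨ ∃ d, r b d ∧ r c d) (hab : EqvGen r a b)
    (han : IsNormalForm r a n) (hbm : IsNormalForm r b m) : E n m := by
  have unique {c k l} (hk : IsNormalForm r c k) (hl : IsNormalForm r c l) : E k l :=
    hk.equiv hwf hE hsim hconf (hE.refl c) hl
  induction hab generalizing n m with
  | rel a b h => exact unique han (hbm.head h)
  | refl a => exact unique han hbm
  | symm a b _ ih => exact hE.symm (ih hbm han)
  | trans a b c _ _ ih₁ ih₂ =>
    obtain ⟨k, hk⟩ := exists_isNormalForm hwf b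
    exact hE.trans (ih₁ han hk) (ih₂ hk hbm)

end RewritingModulo

section Merging

open Relation

variable {T : Type*} [Semigroup T] {P : Set T} {l l' l₁ l₂ : List T}

/-- One step of merging a factorisation in a semigroup: two adjacent factors whose product lies
in `P` are replaced by that product. -/
inductive Merge (P : Set T) : List T → List T → Prop
  | head {x y : T} {l : List T} : x * y ∈ P → Merge P (x :: y :: l) (x * y :: l)
  | cons {x : T} {l₁ l₂ : List T} : Merge P l₁ l₂ → Merge P (x :: l₁) (x :: l₂)

/-- One step of shifting a factorisation in a semigroup: two adjacent factors are replaced by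
factors with the same product, the left one staying in its `ℛ`-class and the right one in its
`ℒ`-class. -/
inductive Shift : List T → List T → Prop
  | head {x y x' y' : T} {l : List T} :
      greenR T x x' → greenL T y y' → x * y = x' * y' → Shift (x :: y :: l) (x' :: y' :: l)
  | cons {x : T} {l₁ l₂ : List T} : Shift l₁ l₂ → Shift (x :: l₁) (x :: l₂)

/-- The property of a set `P` of elements of a semigroup that makes merging confluent modulo
shifting: a product lies in `P` exactly when it stays in the `ℛ`-class of its left factor or in the
`ℒ`-class of its right factor, that factor being in `P`. -/
def IsSplitting (P : Set T) : Prop :=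
  ∀ x y, x * y ∈ P ↔ (x ∈ P ∧ greenR T x (x * y)) ∨ (y ∈ P ∧ greenL T y (x * y))

namespace IsSplitting

variable {x y : T}

theorem mem_of_greenR (hP : IsSplitting P) (hx : x ∈ P) (h : greenR T x y) : y ∈ P := by
  obtain ⟨c, hc⟩ := (greenR_iff.1 h).1
  induction c with
  | one => rwa [WithOne.coe_inj.1 (hc.trans (mul_one _))]
  | coe c =>
    obtain rfl : y = x * c := WithOne.coe_inj.1 hc
    exact (hP x c).2 (.inl ⟨hx, h⟩)

theorem mem_of_greenL (hP : IsSplitting P) (hx : x ∈ P) (h : greenL T x y) : y ∈ P := by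
  obtain ⟨c, hc⟩ := (greenL_iff.1 h).1
  induction c with
  | one => rwa [WithOne.coe_inj.1 (hc.trans (one_mul _))]
  | coe c =>
    obtain rfl : y = c * x := WithOne.coe_inj.1 hc
    exact (hP c x).2 (.inr ⟨hx, h⟩)

theorem greenR_or_greenL (hP : IsSplitting P) (h : x * y ∈ P) :
    greenR T x (x * y) ∨ greenL T y (x * y) :=
  ((hP x y).1 h).imp And.right And.right

end IsSplitting

theorem Merge.length_lt (h : Merge P l l') : l'.length < l.length := by
  induction h with
  | head => simp
  | cons _ ih => simpa using ih

theorem Merge.append_left (k : List T) (h : Merge P l l') : Merge P (k ++ l) (k ++ l') := by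
  induction k with
  | nil => exact h
  | cons x k ih => exact ih.cons

theorem Merge.append_right (k : List T) (h : Merge P l l') : Merge P (l ++ k) (l' ++ k) := by
  induction h with
  | head h => exact .head h
  | cons _ ih => exact ih.cons

theorem wellFounded_flip_merge (P : Set T) : WellFounded (flip (Merge P)) :=
  Subrelation.wf Merge.length_lt (measure List.length).wf

theorem isNormalForm_merge_self (h : l.IsChain fun x y => x * y ∉ P) :
    IsNormalForm (Merge P) l l := by
  refine ⟨.refl, fun l' hl' => ?_⟩
  induction hl' with
  | head hxy => exact (List.isChain_cons_cons.1 h).1 hxy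
  | cons _ ih => exact ih h.tail

theorem Shift.symm (h : Shift l l') : Shift l' l := by
  induction h with
  | head hR hL h => exact .head ((greenR T).symm hR) ((greenL T).symm hL) h.symm
  | cons _ ih => exact ih.cons

instance : Std.Symm (Shift (T := T)) := ⟨fun _ _ => Shift.symm⟩

theorem equivalence_reflTransGen_shift : Equivalence (ReflTransGen (Shift (T := T))) :=
  ⟨fun _ => .refl, ReflTransGen.stdSymm.symm _ _, .trans⟩

theorem Shift.exists_merge (hP : IsSplitting P) (hl : Shift l l') (hm : Merge P l l₁) :
    ∃ l₁', Merge P l' l₁' ∧ (l₁ = l₁' ∨ Shift l₁ l₁') := by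
  induction hl generalizing l₁ with
  | @head x y x' y' l hR hL h =>
    cases hm with
    | head hxy => exact ⟨_, .head (h ▸ hxy), .inl (by rw [h])⟩
    | cons hm =>
      cases hm with
      | @head _ z _ hyz =>
        have hL' := greenL_mul_right z hL
        exact ⟨_, .cons (.head (hP.mem_of_greenL hyz hL')),
          .inr (.head hR hL' (by rw [← mul_assoc, h, mul_assoc]))⟩
      | cons hm => exact ⟨_, .cons (.cons hm), .inr (.head hR hL h)⟩
  | @cons w l l' hl ih =>
    cases hm with
    | head hwx =>
      cases hl with
      | head hR hL h =>
        have hR' := greenR_mul_left w hR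
        exact ⟨_, .head (hP.mem_of_greenR hwx hR'),
          .inr (.head hR' hL (by rw [mul_assoc, h, mul_assoc]))⟩
      | cons hl => exact ⟨_, .head hwx, .inr (.cons hl)⟩
    | cons hm =>
      obtain ⟨k, hk, h⟩ := ih hm
      exact ⟨_, hk.cons, h.imp (congrArg _) .cons⟩

theorem exists_merge_of_reflTransGen_shift (hP : IsSplitting P) (hl : ReflTransGen Shift l l')
    (hm : Merge P l l₁) : ∃ l₁', Merge P l' l₁' ∧ ReflTransGen Shift l₁ l₁' := by
  induction hl with
  | refl => exact ⟨l₁, hm, .refl⟩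
  | tail _ hs ih =>
    obtain ⟨k, hk, hlk⟩ := ih
    obtain ⟨k', hk', rfl | h⟩ := hs.exists_merge hP hk
    · exact ⟨k, hk', hlk⟩
    · exact ⟨k', hk', hlk.tail h⟩

theorem shift_or_join_of_mul_mem (hP : IsSplitting P) {x y z : T} (hxy : x * y ∈ P)
    (hyz : y * z ∈ P) (l : List T) : Shift (x * y :: z :: l) (x :: y * z :: l) ∨
      ∃ k, Merge P (x * y :: z :: l) k ∧ Merge P (x :: y * z :: l) k := by
  by_cases hxyz : x * y * z ∈ P
  · exact .inr ⟨x * y * z :: l, .head hxyz, mul_assoc x y z ▸ .head (mul_assoc x y z ▸ hxyz)⟩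
  refine .inl (.head ?_ ?_ (mul_assoc x y z))
  · refine (greenR T).symm ((hP.greenR_or_greenL hxy).resolve_right fun h => hxyz ?_)
    exact hP.mem_of_greenL hyz (greenL_mul_right z h)
  · refine (hP.greenR_or_greenL hyz).resolve_left fun h => hxyz ?_
    exact mul_assoc x y z ▸ hP.mem_of_greenR hxy (greenR_mul_left x h)

theorem Merge.eq_or_shift_or_join (hP : IsSplitting P) (h₁ : Merge P l l₁) (h₂ : Merge P l l₂) :
    l₁ = l₂ ∨ Shift l₁ l₂ ∨ ∃ k, Merge P l₁ k ∧ Merge P l₂ k := by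
  induction h₁ generalizing l₂ with
  | head hxy =>
    cases h₂ with
    | head => exact .inl rfl
    | cons h₂ =>
      cases h₂ with
      | head hyz => exact .inr (shift_or_join_of_mul_mem hP hxy hyz _)
      | cons h₂ => exact .inr (.inr ⟨_, h₂.cons, .head hxy⟩)
  | cons h₁ ih =>
    cases h₂ with
    | head hxy =>
      cases h₁ with
      | head hyz =>
        exact .inr ((shift_or_join_of_mul_mem hP hxy hyz _).imp Shift.symm
          fun ⟨k, hk₁, hk₂⟩ => ⟨k, hk₂, hk₁⟩)
      | cons h₁ => exact .inr (.inr ⟨_, .head hxy, h₁.cons⟩)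
    | cons h₂ =>
      rcases ih h₂ with rfl | h | ⟨k, hk₁, hk₂⟩
      · exact .inl rfl
      · exact .inr (.inl h.cons)
      · exact .inr (.inr ⟨_, hk₁.cons, hk₂.cons⟩)

theorem reflTransGen_shift_of_eqvGen_merge (hP : IsSplitting P) (h : EqvGen (Merge P) l₁ l₂)
    (h₁ : l₁.IsChain fun x y => x * y ∉ P) (h₂ : l₂.IsChain fun x y => x * y ∉ P) :
    ReflTransGen Shift l₁ l₂ := by
  refine (isNormalForm_merge_self h₁).equiv_of_eqvGen (wellFounded_flip_merge P)
    equivalence_reflTransGen_shift (exists_merge_of_reflTransGen_shift hP) (fun hb hc => ?_) h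
    (isNormalForm_merge_self h₂)
  rcases hb.eq_or_shift_or_join hP hc with rfl | h | h
  · exact .inl .refl
  · exact .inl (.single h)
  · exact .inr h

end Merging

section Fingerprint

open Relation

variable {T : Type*} [Semigroup T] {l l' : List T}

/-- The fingerprint of a sequence of elements of a semigroup: their `𝒟`-classes, the `ℛ`-class of
the first element and the `ℒ`-class of the last one (`none` for the empty sequence). -/
def fingerprint (l : List T) : List (Quotient (greenD T)) × Option (Quotient (greenR T)) ×
    Option (Quotient (greenL T)) :=
  (l.map (Quotient.mk (greenD T)), l.head?.map (Quotient.mk (greenR T)),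
    l.getLast?.map (Quotient.mk (greenL T)))

theorem fingerprint_cons (x : T) (l : List T) : fingerprint (x :: l) =
    (Quotient.mk _ x :: (fingerprint l).1, some (Quotient.mk _ x),
      some ((fingerprint l).2.2.getD (Quotient.mk _ x))) := by
  simp [fingerprint, List.getLast?_cons, Option.getD_map]

theorem Shift.fingerprint_eq (h : Shift l l') : fingerprint l = fingerprint l' := by
  induction h with
  | @head x y x' y' l hR hL _ =>
    have hxD : greenD T x x' := (le_sup_left : greenR T ≤ greenD T) hR
    have hyD : greenD T y y' := (le_sup_right : greenL T ≤ greenD T) hL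
    simp only [fingerprint_cons, Quotient.sound hxD, Quotient.sound hyD, Quotient.sound hR,
      Quotient.sound hL, Option.getD_some]
  | cons _ ih => rw [fingerprint_cons, fingerprint_cons, ih]

theorem fingerprint_eq_of_reflTransGen_shift (h : ReflTransGen Shift l l') :
    fingerprint l = fingerprint l' := by
  induction h with
  | refl => rfl
  | tail _ hs ih => exact ih.trans hs.fingerprint_eq

theorem length_eq_of_fingerprint_eq (h : fingerprint l = fingerprint l') :
    l.length = l'.length := by
  simpa [fingerprint] using congrArg (fun F => F.1.length) h

theorem greenD_getElem_of_fingerprint_eq (h : fingerprint l = fingerprint l') {i : ℕ}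
    (hl : i < l.length) (hl' : i < l'.length) : greenD T l[i] l'[i] := by
  have hD : l.map (Quotient.mk (greenD T)) = l'.map (Quotient.mk (greenD T)) := congrArg Prod.fst h
  refine Quotient.exact ?_
  rw [← List.getElem_map (Quotient.mk (greenD T)) (h := by simpa using hl), List.getElem_of_eq hD,
    List.getElem_map]

theorem greenR_head_of_fingerprint_eq (h : fingerprint l = fingerprint l') (hl : l ≠ [])
    (hl' : l' ≠ []) : greenR T (l.head hl) (l'.head hl') := by
  have hR : l.head?.map (Quotient.mk (greenR T)) = l'.head?.map (Quotient.mk (greenR T)) :=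
    congrArg (fun F => F.2.1) h
  rw [List.head?_eq_some_head hl, List.head?_eq_some_head hl'] at hR
  exact Quotient.exact (Option.some_injective _ hR)

theorem greenL_getLast_of_fingerprint_eq (h : fingerprint l = fingerprint l') (hl : l ≠ [])
    (hl' : l' ≠ []) : greenL T (l.getLast hl) (l'.getLast hl') := by
  have hL : l.getLast?.map (Quotient.mk (greenL T)) = l'.getLast?.map (Quotient.mk (greenL T)) :=
    congrArg (fun F => F.2.2) h
  rw [List.getLast?_eq_some_getLast hl, List.getLast?_eq_some_getLast hl'] at hL
  exact Quotient.exact (Option.some_injective _ hL)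

end Fingerprint

section MergeMonoid

open Relation

variable {T : Type*} [Semigroup T] {P : Set T}

theorem eqvGen_merge_append {k k' l l' : List T} (hk : EqvGen (Merge P) k k')
    (hl : EqvGen (Merge P) l l') : EqvGen (Merge P) (k ++ l) (k' ++ l') := by
  have hright : EqvGen.setoid (Merge P) ≤ (EqvGen.setoid (Merge P)).comap (· ++ l) :=
    Setoid.eqvGen_le fun _ _ h => .rel _ _ (h.append_right l)
  have hleft : EqvGen.setoid (Merge P) ≤ (EqvGen.setoid (Merge P)).comap (k' ++ ·) :=
    Setoid.eqvGen_le fun _ _ h => .rel _ _ (h.append_left k')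
  exact .trans _ _ _ (hright hk) (hleft hl)

/-- The congruence on the free monoid over a semigroup that identifies two sequences when they are
connected by merging steps and their inverses. -/
def mergeCon (P : Set T) : Con (FreeMonoid T) where
  toSetoid := (EqvGen.setoid (Merge P)).comap FreeMonoid.toList
  mul' := eqvGen_merge_append

/-- The monoid of sequences of elements of a semigroup up to merging and its inverse. -/
abbrev MergeMonoid (P : Set T) : Type _ := (mergeCon P).Quotient

/-- The class in the merge monoid of a sequence of length one. -/
def MergeMonoid.of (P : Set T) (x : T) : MergeMonoid P := (FreeMonoid.of x : FreeMonoid T)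

namespace MergeMonoid

theorem of_mul_of {x y : T} (h : x * y ∈ P) : of P x * of P y = of P (x * y) :=
  (mergeCon P).eq.2 (.rel _ _ (.head h))

theorem prod_map_of_eq_iff {l l' : List T} :
    (l.map (of P)).prod = (l'.map (of P)).prod ↔ EqvGen (Merge P) l l' := by
  have prod_map_of (l : List T) : (l.map (of P)).prod = (FreeMonoid.ofList l : FreeMonoid T) := by
    induction l with
    | nil => rfl
    | cons x l ih => rw [List.map_cons, List.prod_cons, ih]; rfl
  rw [prod_map_of, prod_map_of]
  exact (mergeCon P).eq

end MergeMonoid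

end MergeMonoid

section Seeds

variable {M : Type*} [Monoid M] {e f z t x y w : M}

/-- `t` is a seed between `z` and `y`: `z t ℒ t ℛ t y` in the monoid. -/
def IsSeed (z t y : M) : Prop := (∃ c, c * (z * t) = t) ∧ t * y ∣ t

theorem isSeed_one_iff : IsSeed 1 x y ↔ x * y ∣ x :=
  and_iff_right ⟨1, by rw [one_mul, one_mul]⟩

theorem isSeed_iff_one : IsSeed z x 1 ↔ ∃ c, c * (z * x) = x :=
  and_iff_left (by rw [mul_one])

theorem isSeed_one_one : IsSeed 1 x 1 :=
  isSeed_one_iff.2 (by rw [mul_one])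

theorem isSeed_mul_right_iff : IsSeed z x (y * w) ↔ IsSeed 1 x y ∧ IsSeed z (x * y) w := by
  rw [isSeed_one_iff]
  constructor
  · rintro ⟨⟨c, hc⟩, h⟩
    rw [← mul_assoc] at h
    refine ⟨(dvd_mul_right _ _).trans h, ⟨c, ?_⟩, h.trans (dvd_mul_right _ _)⟩
    rw [← mul_assoc z, ← mul_assoc, hc]
  · rintro ⟨⟨d, hd⟩, ⟨c, hc⟩, h⟩
    refine ⟨⟨c, ?_⟩, ?_⟩
    · calc c * (z * x) = c * (z * (x * y * d)) := by rw [← hd]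
        _ = c * (z * (x * y)) * d := by simp only [mul_assoc]
        _ = x := by rw [hc, ← hd]
    · rw [← mul_assoc]
      exact h.trans ⟨d, hd⟩

theorem isSeed_mul_left_iff : IsSeed (z * x) y w ↔ IsSeed x y 1 ∧ IsSeed z (x * y) w := by
  rw [isSeed_iff_one]
  constructor
  · rintro ⟨⟨c, hc⟩, d, hd⟩
    refine ⟨⟨c * z, ?_⟩, ⟨x * c, ?_⟩, d, ?_⟩
    · rw [mul_assoc c, ← mul_assoc z, hc]
    · rw [mul_assoc, ← mul_assoc z, hc]
    · rw [mul_assoc x, mul_assoc x, ← hd]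
  · rintro ⟨⟨c, hc⟩, ⟨d, hd⟩, k, hk⟩
    refine ⟨⟨c * d, ?_⟩, k, ?_⟩
    · rw [mul_assoc, mul_assoc z, hd, hc]
    · calc y = c * (x * y) := hc.symm
        _ = c * (x * y * w * k) := by rw [← hk]
        _ = c * (x * y) * w * k := by simp only [mul_assoc]
        _ = y * w * k := by rw [hc]

theorem isSeed_mul_iff (h : IsSeed 1 e f ∨ IsSeed e f 1) :
    IsSeed z (e * f) y ↔ IsSeed z e (f * y) ∨ IsSeed (z * e) f y := by
  rw [isSeed_mul_right_iff, isSeed_mul_left_iff]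
  tauto

variable (M) in
/-- The extension of a monoid `M` by the predicates on `M × M`, on which `M` acts by translating
either argument. A homomorphism to it is a homomorphism `φ` to `M` with a derivation, a map `δ` to
the predicates such that `δ (a b) (z, y) ↔ δ a (z, φ b · y) ∨ δ b (z · φ a, y)`. -/
@[ext]
structure SeedExtension where
  val : M
  pred : M → M → Prop

instance : Semigroup (SeedExtension M) where
  mul a b := ⟨a.val * b.val, fun z y => a.pred z (b.val * y) ∨ b.pred (z * a.val) y⟩
  mul_assoc a b c := by
    refine SeedExtension.ext (mul_assoc _ _ _) (funext₂ fun z y => propext ?_)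
    change (a.pred z (b.val * (c.val * y)) ∨ b.pred (z * a.val) (c.val * y)) ∨
      c.pred (z * (a.val * b.val)) y ↔ a.pred z (b.val * c.val * y) ∨
        b.pred (z * a.val) (c.val * y) ∨ c.pred (z * a.val * b.val) y
    simp only [mul_assoc, or_assoc]

namespace SeedExtension

theorem val_mul (a b : SeedExtension M) : (a * b).val = a.val * b.val := rfl

theorem pred_mul (a b : SeedExtension M) (z y : M) :
    (a * b).pred z y ↔ a.pred z (b.val * y) ∨ b.pred (z * a.val) y := Iff.rfl

end SeedExtension

end Seeds

section IG

variable {S : Type*} [Semigroup S]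

theorem BasicPair.refl (e : Idempotents S) : BasicPair e e :=
  ⟨e, .inl rfl, .inl e.2.symm⟩

theorem BasicPair.symm {e f : Idempotents S} (h : BasicPair e f) : BasicPair f e := by
  rwa [BasicPair, Set.pair_comm, Set.pair_comm (_ * _)]

theorem BasicPair.star_self (e : Idempotents S) : (BasicPair.refl e).star = e :=
  Subtype.ext e.2

namespace IG

/-- The generator `ē` of `IG(ℰ)`. -/
def of (e : Idempotents S) : IG S := bar (FreeSemigroup.of e)

theorem of_mul_of {e f : Idempotents S} (h : BasicPair e f) : of e * of f = of h.star :=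
  (Con.eq _).2 (.of _ _ (.basic e f h))

theorem isIdempotentElem_of (e : Idempotents S) : IsIdempotentElem (of e) := by
  rw [IsIdempotentElem, of_mul_of (.refl e), BasicPair.star_self]

@[elab_as_elim]
theorem induction {motive : IG S → Prop} (of : ∀ e, motive (of e))
    (mul : ∀ x y, motive x → motive y → motive (x * y)) (x : IG S) : motive x := by
  obtain ⟨w, rfl⟩ : ∃ w, bar w = x := Quot.exists_rep x
  induction w using FreeSemigroup.recOnMul with
  | ih1 e => exact of e
  | ih2 e w he hw => exact map_mul bar (FreeSemigroup.of e) w ▸ mul _ _ he hw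

theorem of_mul_of_mul_of_eq_or {e f : Idempotents S} (h : BasicPair e f) :
    of e * of f * of e = of e ∨ of f * of e * of f = of f := by
  have he := isIdempotentElem_of e
  have hf := isIdempotentElem_of f
  have hef := of_mul_of h
  have hfe := of_mul_of h.symm
  obtain ⟨x, rfl | rfl, hx | hx⟩ := id h
  · rw [show h.star = e from Subtype.ext hx.symm] at hef
    exact .inl (by rw [hef, he])
  · rw [show h.symm.star = e from Subtype.ext hx.symm] at hfe
    exact .inl (by rw [mul_assoc, hfe, he])
  · rw [show h.star = f from Subtype.ext hx.symm] at hef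
    exact .inr (by rw [mul_assoc, hef, hf])
  · rw [show h.symm.star = f from Subtype.ext hx.symm] at hfe
    exact .inr (by rw [hfe, hf])

section Lift

variable {N : Type*} [Semigroup N] (g : Idempotents S → N)
  (hg : ∀ e f (h : BasicPair e f), g e * g f = g h.star)

/-- The universal property of `IG(ℰ)`: a map on idempotents that respects the defining relations
extends to a homomorphism. -/
def lift : IG S →ₙ* N where
  toFun x := Con.liftOn x (FreeSemigroup.lift g) fun _ _ h =>
    (Con.conGen_le (c := Con.ker (FreeSemigroup.lift g))).2
      (by rintro _ _ ⟨e, f, h⟩; simpa using hg e f h) h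
  map_mul' x y := Con.induction_on₂ x y fun u v => map_mul (FreeSemigroup.lift g) u v

theorem lift_of (e : Idempotents S) : lift g hg (of e) = g e := FreeSemigroup.lift_of g e

end Lift

end IG

end IG

section HasSeed

namespace IG

variable {S : Type*} [Semigroup S]

/-- The value of `seedHom` at a generator: the generator, paired with its seeds. -/
def letterSeed (e : Idempotents S) : SeedExtension (WithOne (IG S)) :=
  ⟨of e, fun z y => IsSeed z (of e) y⟩

theorem letterSeed_mul {e f : Idempotents S} (h : BasicPair e f) :
    letterSeed e * letterSeed f = letterSeed h.star := by
  have hval : (of e * of f : WithOne (IG S)) = of h.star := by rw [← WithOne.coe_mul, of_mul_of h]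
  have hseed : IsSeed 1 (of e : WithOne (IG S)) (of f) ∨
      IsSeed (of e : WithOne (IG S)) (of f) 1 := by
    rw [isSeed_one_iff, isSeed_iff_one]
    exact (of_mul_of_mul_of_eq_or h).imp (fun h => ⟨of e, by norm_cast; exact h.symm⟩)
      fun h => ⟨of f, by norm_cast⟩
  refine SeedExtension.ext hval (funext₂ fun z y => propext ?_)
  exact (isSeed_mul_iff hseed).symm.trans (iff_of_eq (congrArg (IsSeed z · y) hval))

/-- The homomorphism that pairs an element of `IG(ℰ)` with the set of `(z, y)` such that, along a
word representing the element, some letter `t` is a seed between `z` times the letters before `t`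
and the letters after `t` times `y`. -/
def seedHom : IG S →ₙ* SeedExtension (WithOne (IG S)) := lift letterSeed fun _ _ => letterSeed_mul

theorem val_seedHom (x : IG S) : (seedHom x).val = x := by
  induction x using IG.induction with
  | of e => rfl
  | mul x y hx hy => rw [map_mul, SeedExtension.val_mul, hx, hy, WithOne.coe_mul]

/-- Some letter of a word representing `x` is a seed in the word extended by `z` on the left and by
`y` on the right; by `seedHom`, the choice of the word does not matter. -/
def HasSeed (z : WithOne (IG S)) (x : IG S) (y : WithOne (IG S)) : Prop := (seedHom x).pred z y

variable {z w : WithOne (IG S)} {x y : IG S}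

theorem hasSeed_of {e : Idempotents S} : HasSeed z (of e) w ↔ IsSeed z (of e : WithOne (IG S)) w :=
  Iff.rfl

theorem hasSeed_mul : HasSeed z (x * y) w ↔
    HasSeed z x (y * w) ∨ HasSeed (z * (x : WithOne (IG S))) y w := by
  rw [HasSeed, map_mul, SeedExtension.pred_mul, val_seedHom, val_seedHom]
  rfl

theorem hasSeed_iff : HasSeed z x w ↔ HasSeed 1 x 1 ∧ IsSeed z (x : WithOne (IG S)) w := by
  induction x using IG.induction generalizing z w with
  | of e => rw [hasSeed_of, hasSeed_of, and_iff_right isSeed_one_one]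
  | mul x y hx hy =>
    rw [hasSeed_mul, hasSeed_mul, mul_one, one_mul, hx (w := y * w), hy (z := z * x),
      hx (w := y), hy (z := x), WithOne.coe_mul, isSeed_mul_right_iff, isSeed_mul_left_iff]
    tauto

theorem isSplitting_hasSeed : IsSplitting {x : IG S | HasSeed 1 x 1} := by
  intro x y
  rw [Set.mem_ofPred_eq, hasSeed_mul, mul_one, one_mul, hasSeed_iff (x := x),
    hasSeed_iff (x := y), isSeed_one_iff, isSeed_iff_one, greenR_mul_iff, greenL_mul_iff]
  simp only [Set.mem_ofPred_eq, eq_comm]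

end IG

end HasSeed

section FactorisationsIn

variable {A : Type*} {Q : Set (FreeSemigroup A)} {u v w x y : FreeSemigroup A}
  {k l p q : List (FreeSemigroup A)}

theorem letters_mul (u v : FreeSemigroup A) : (u * v).letters = u.letters ++ v.letters := rfl

theorem letters_ne_nil (u : FreeSemigroup A) : u.letters ≠ [] := List.cons_ne_nil _ _

theorem letters_injective : Function.Injective (FreeSemigroup.letters : FreeSemigroup A → List A) :=
  fun _ _ h => FreeSemigroup.ext (List.cons.inj h).1 (List.cons.inj h).2

theorem prod_map_letters {N : Type*} [Monoid N] (f : FreeSemigroup A →ₙ* N) (w : FreeSemigroup A) :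
    (w.letters.map fun a => f (.of a)).prod = f w := by
  induction w using FreeSemigroup.recOnMul with
  | ih1 a => exact List.prod_singleton
  | ih2 a w ha hw => rw [letters_mul, List.map_append, List.prod_append, ha, hw, map_mul]

namespace IsFactorisation

theorem ne_nil (h : IsFactorisation w p) : p ≠ [] := by
  rintro rfl
  exact letters_ne_nil w h.symm

theorem eq_of_singleton (h : IsFactorisation w [x]) : x = w :=
  letters_injective ((List.append_nil _).symm.trans h)

theorem prod_map {N : Type*} [Monoid N] (f : FreeSemigroup A →ₙ* N) (h : IsFactorisation w p) :
    (p.map f).prod = f w := by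
  rw [← prod_map_letters f w, ← h, List.map_flatten, List.prod_flatten, List.map_map, List.map_map]
  exact congrArg List.prod (List.map_congr_left fun x _ => (prod_map_letters f x).symm)

theorem merge (h : IsFactorisation w (k ++ x :: y :: l)) : IsFactorisation w (k ++ x * y :: l) := by
  simpa [IsFactorisation, letters_mul] using h

theorem split (h : IsFactorisation (u * v) q) :
    (∃ k l, q = k ++ l ∧ IsFactorisation u k ∧ IsFactorisation v l) ∨
      ∃ k s t l, q = k ++ s * t :: l ∧ IsFactorisation u (k ++ [s]) ∧
        IsFactorisation v (t :: l) := by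
  have h : (q.map FreeSemigroup.letters).flatten = u.letters ++ v.letters := h
  rcases List.flatten_eq_append_iff.1 h with
    ⟨_, _, hq, hu, hv⟩ | ⟨_, bs, c, cs, _, hq, hu, hv⟩
  · obtain ⟨k, l, rfl, rfl, rfl⟩ := List.map_eq_append_iff.1 hq
    exact .inl ⟨k, l, rfl, hu.symm, hv.symm⟩
  obtain ⟨k, _, rfl, rfl, hq'⟩ := List.map_eq_append_iff.1 hq
  obtain ⟨z, l, rfl, hz, rfl⟩ := List.map_eq_cons_iff.1 hq'
  rcases bs with - | ⟨b, bs⟩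
  · refine .inl ⟨k, z :: l, rfl, ?_, ?_⟩
    · rw [IsFactorisation, hu, List.append_nil]
    · rw [IsFactorisation, hv, List.map_cons, List.flatten_cons, hz, List.nil_append]
  · obtain rfl : z = ⟨b, bs⟩ * ⟨c, cs⟩ := letters_injective hz
    refine .inr ⟨k, ⟨b, bs⟩, ⟨c, cs⟩, l, rfl, ?_, hv.symm⟩
    rw [IsFactorisation, hu, List.map_append, List.flatten_append]
    simp [FreeSemigroup.letters]

end IsFactorisation

theorem forall₂_isFactorisation_singleton (p : List (FreeSemigroup A)) :
    List.Forall₂ IsFactorisation p (p.map fun x => [x]) :=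
  List.forall₂_map_right_iff.2 (List.forall₂_same.2 fun x _ => List.append_nil x.letters)

theorem coarser_mul (k l : List (FreeSemigroup A)) (x y : FreeSemigroup A) :
    Coarser (k ++ x * y :: l) (k ++ x :: y :: l) := by
  refine ⟨k.map (fun x => [x]) ++ [x, y] :: l.map fun x => [x], ?_, ?_⟩
  · simp [← List.flatMap_def]
  · exact List.rel_append (forall₂_isFactorisation_singleton k)
      (.cons (by simp [IsFactorisation, letters_mul]) (forall₂_isFactorisation_singleton l))

theorem Coarser.length_lt_or_eq (h : Coarser p q) : p.length < q.length ∨ p = q := by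
  obtain ⟨blocks, rfl, h⟩ := h
  induction h with
  | nil => exact .inr rfl
  | @cons x B p Bs hx _ ih =>
    rcases B with - | ⟨y, - | ⟨y', B⟩⟩
    · exact absurd rfl hx.ne_nil
    · rw [hx.eq_of_singleton]
      exact ih.imp Nat.succ_lt_succ (congrArg (x :: ·))
    · have := ih.elim le_of_lt fun h => (congrArg List.length h).le
      simp only [List.length_cons, List.flatten_cons, List.length_append]
      exact .inl (by omega)

/-- `p` is a factorisation of `w` all of whose factors lie in `Q`. -/
def IsFactorisationIn (Q : Set (FreeSemigroup A)) (w : FreeSemigroup A)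
    (p : List (FreeSemigroup A)) : Prop :=
  IsFactorisation w p ∧ ∀ x ∈ p, x ∈ Q

/-- `p` is minimal for `≼` among the factorisations of `w` into members of `Q`. -/
def IsMinimalFactorisationIn (Q : Set (FreeSemigroup A)) (w : FreeSemigroup A)
    (p : List (FreeSemigroup A)) : Prop :=
  IsFactorisationIn Q w p ∧ ∀ q, IsFactorisationIn Q w q → Coarser q p → q = p

theorem IsMinimalFactorisationIn.isChain (h : IsMinimalFactorisationIn Q w p) :
    p.IsChain fun x y => x * y ∉ Q := by
  rw [List.isChain_iff_forall_rel_of_append_cons_cons]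
  rintro x y k l rfl hxy
  have heq : k ++ x * y :: l = k ++ x :: y :: l := by
    refine h.2 _ ⟨h.1.1.merge, fun z hz => ?_⟩ (coarser_mul k l x y)
    have hQ := h.1.2
    simp only [List.mem_append, List.mem_cons] at hz hQ
    rcases hz with hz | rfl | hz
    exacts [hQ z (.inl hz), hxy, hQ z (.inr (.inr (.inr hz)))]
  simpa using congrArg List.length heq

theorem exists_isMinimalFactorisationIn (hQ : ∀ a, .of a ∈ Q) (w : FreeSemigroup A) :
    ∃ p, IsMinimalFactorisationIn Q w p ∧ ∀ q, IsFactorisationIn Q w q → p.length ≤ q.length := by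
  have hw : IsFactorisationIn Q w (w.letters.map .of) := by
    refine ⟨?_, List.forall_mem_map.2 fun a _ => hQ a⟩
    rw [IsFactorisation, List.map_map]
    exact (List.flatMap_def ..).symm.trans (List.flatMap_singleton' _)
  obtain ⟨p, hp, hmin⟩ := (measure List.length).wf.has_min {p | IsFactorisationIn Q w p} ⟨_, hw⟩
  have hmin (q) (hq : IsFactorisationIn Q w q) : p.length ≤ q.length := not_lt.1 (hmin q hq)
  exact ⟨p, ⟨hp, fun q hq h => h.length_lt_or_eq.resolve_left (hmin q hq).not_gt⟩, hmin⟩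

end FactorisationsIn

section IdempotentMem

variable {T : Type*} [Semigroup T] {P : Set T} {x s : T} {c : WithOne T}

theorem IsSplitting.mem_of_mul_left_mem (hP : IsSplitting P) (hx : IsIdempotentElem x)
    (hc : (x : WithOne T) = c * s) (h : s * x ∈ P) : x ∈ P := by
  refine hP.mem_of_greenL h ((greenL T).symm (greenL_mul_iff.2 ⟨c, ?_⟩))
  rw [← mul_assoc, ← hc, ← WithOne.coe_mul, hx]

theorem IsSplitting.mem_of_mul_right_mem (hP : IsSplitting P) (hx : IsIdempotentElem x)
    (hc : (x : WithOne T) = s * c) (h : x * s ∈ P) : x ∈ P := by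
  refine hP.mem_of_greenR h ((greenR T).symm (greenR_mul_iff.2 ⟨c, ?_⟩))
  rw [mul_assoc, ← hc, ← WithOne.coe_mul, hx]

end IdempotentMem

section SplittingIG

namespace IG

open Relation

variable {S : Type*} [Semigroup S] {P : Set (IG S)} {u v w : FreeSemigroup (Idempotents S)}
  {p q : List (FreeSemigroup (Idempotents S))} {x y : IG S}

/-- The homomorphism from `IG(ℰ)` to the merge monoid of a set of its elements that contains the
generators; it sends each generator to its class. -/
def toMergeMonoid (hof : ∀ e, of e ∈ P) : IG S →ₙ* MergeMonoid P :=
  lift (fun e => .of P (of e)) fun _ _ h =>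
    of_mul_of h ▸ MergeMonoid.of_mul_of (of_mul_of h ▸ hof h.star)

theorem toMergeMonoid_of (hof : ∀ e, of e ∈ P) (e : Idempotents S) :
    toMergeMonoid hof (of e) = .of P (of e) := by
  rw [toMergeMonoid, lift_of]

theorem of_mul_toMergeMonoid (hP : IsSplitting P) (hof : ∀ e, of e ∈ P) (hx : x ∈ P)
    (h : greenR (IG S) x (x * y)) :
    MergeMonoid.of P x * toMergeMonoid hof y = .of P (x * y) := by
  induction y using IG.induction generalizing x with
  | of e => rw [toMergeMonoid_of, MergeMonoid.of_mul_of (hP.mem_of_greenR hx h)]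
  | mul a b iha ihb =>
    have ha : greenR (IG S) x (x * a) := greenR_mul_of_greenR_mul_mul h
    rw [map_mul, ← mul_assoc, iha hx ha, ihb (hP.mem_of_greenR hx ha), mul_assoc]
    exact mul_assoc x a b ▸ (greenR _).trans ((greenR _).symm ha) h

theorem toMergeMonoid_mul_of (hP : IsSplitting P) (hof : ∀ e, of e ∈ P) (hx : x ∈ P)
    (h : greenL (IG S) x (y * x)) :
    toMergeMonoid hof y * MergeMonoid.of P x = .of P (y * x) := by
  induction y using IG.induction generalizing x with
  | of e => rw [toMergeMonoid_of, MergeMonoid.of_mul_of (hP.mem_of_greenL hx h)]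
  | mul a b iha ihb =>
    have hb : greenL (IG S) x (b * x) := greenL_mul_of_greenL_mul_mul h
    rw [map_mul, mul_assoc, ihb hx hb, iha (hP.mem_of_greenL hx hb), mul_assoc]
    exact mul_assoc a b x ▸ (greenL _).trans ((greenL _).symm hb) h

theorem toMergeMonoid_of_mem (hP : IsSplitting P) (hof : ∀ e, of e ∈ P) (hx : x ∈ P) :
    toMergeMonoid hof x = .of P x := by
  induction x using IG.induction with
  | of e => exact toMergeMonoid_of hof e
  | mul x y ihx ihy =>
    rcases (hP x y).1 hx with ⟨hx, h⟩ | ⟨hy, h⟩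
    · rw [map_mul, ihx hx, of_mul_toMergeMonoid hP hof hx h]
    · rw [map_mul, ihy hy, toMergeMonoid_mul_of hP hof hy h]

theorem reflTransGen_shift_of_bar_eq (hP : IsSplitting P) (hof : ∀ e, of e ∈ P)
    (huv : bar u = bar v) (hp : IsMinimalFactorisationIn (bar ⁻¹' P) u p)
    (hq : IsMinimalFactorisationIn (bar ⁻¹' P) v q) :
    ReflTransGen Shift (p.map bar) (q.map bar) := by
  have prod_map_bar {w p} (h : IsMinimalFactorisationIn (bar ⁻¹' P) w p) :
      ((p.map bar).map (MergeMonoid.of P)).prod = toMergeMonoid hof (bar w) := by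
    rw [List.map_map, ← MulHom.comp_apply, ← h.1.1.prod_map]
    exact congrArg _ (List.map_congr_left fun x hx =>
      (toMergeMonoid_of_mem hP hof (h.1.2 x hx)).symm)
  have isChain {w p} (h : IsMinimalFactorisationIn (bar ⁻¹' P) w p) :
      (p.map bar).IsChain fun x y => x * y ∉ P := (List.isChain_map bar).2 h.isChain
  refine reflTransGen_shift_of_eqvGen_merge hP ?_ (isChain hp) (isChain hq)
  rw [← MergeMonoid.prod_map_of_eq_iff, prod_map_bar hp, prod_map_bar hq, huv]

theorem fingerprint_eq_of_bar_eq (hP : IsSplitting P) (hof : ∀ e, of e ∈ P)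
    (huv : bar u = bar v) (hp : IsMinimalFactorisationIn (bar ⁻¹' P) u p)
    (hq : IsMinimalFactorisationIn (bar ⁻¹' P) v q) :
    fingerprint (p.map bar) = fingerprint (q.map bar) :=
  fingerprint_eq_of_reflTransGen_shift (reflTransGen_shift_of_bar_eq hP hof huv hp hq)

theorem mem_of_isFactorisationIn_mul_self (hP : IsSplitting P) (hw : IsIdempotentElem (bar w))
    (hp : ∀ p, IsFactorisationIn (bar ⁻¹' P) w p → q.length ≤ p.length)
    (hq : IsFactorisationIn (bar ⁻¹' P) (w * w) q) : bar w ∈ P := by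
  obtain ⟨hq, hqP⟩ := hq
  rcases hq.split with ⟨k, l, rfl, hk, hl⟩ | ⟨k, s, t, l, rfl, hk, hl⟩
  · have hlen := hp k ⟨hk, fun x hx => hqP x (List.mem_append_left l hx)⟩
    have : 0 < l.length := List.length_pos_of_ne_nil hl.ne_nil
    rw [List.length_append] at hlen
    omega
  have hst : bar s * bar t ∈ P := map_mul bar s t ▸ hqP (s * t) (by simp)
  rcases (hP _ _).1 hst with ⟨hs, -⟩ | ⟨ht, -⟩
  · have hlen := hp (k ++ [s]) ⟨hk, fun x hx => by
      rcases List.mem_append.1 hx with hx | hx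
      · exact hqP x (List.mem_append_left _ hx)
      · exact List.mem_singleton.1 hx ▸ hs⟩
    obtain rfl : l = [] := List.length_eq_zero_iff.1 (by simpa using hlen)
    obtain rfl := hl.eq_of_singleton
    have hc := hk.prod_map (WithOne.coeMulHom.comp bar)
    rw [List.map_append, List.prod_append, List.map_singleton, List.prod_singleton] at hc
    exact hP.mem_of_mul_left_mem hw hc.symm hst
  · have hlen := hp (t :: l) ⟨hl, fun x hx => by
      rcases List.mem_cons.1 hx with rfl | hx
      · exact ht
      · exact hqP x (by simp [hx])⟩
    obtain rfl : k = [] := List.length_eq_zero_iff.1 (by simpa using hlen)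
    obtain rfl := hk.eq_of_singleton
    have hc := hl.prod_map (WithOne.coeMulHom.comp bar)
    rw [List.map_cons, List.prod_cons] at hc
    exact hP.mem_of_mul_right_mem hw hc.symm hst

theorem mem_of_isIdempotentElem (hP : IsSplitting P) (hof : ∀ e, of e ∈ P)
    (hx : IsIdempotentElem x) : x ∈ P := by
  obtain ⟨w, rfl⟩ : ∃ w, bar w = x := Quot.exists_rep x
  obtain ⟨p, hp, hmin⟩ := exists_isMinimalFactorisationIn (Q := bar ⁻¹' P) hof w
  obtain ⟨q, hq, -⟩ := exists_isMinimalFactorisationIn (Q := bar ⁻¹' P) hof (w * w)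
  have hlen : p.length = q.length := by
    have hw : bar w = bar (w * w) := ((map_mul bar w w).trans hx).symm
    simpa using length_eq_of_fingerprint_eq (fingerprint_eq_of_bar_eq hP hof hw hp hq)
  exact mem_of_isFactorisationIn_mul_self hP hx (hlen ▸ hmin) hq.1

theorem isRegularElem_of (e : Idempotents S) : IsRegularElem (of e) :=
  ⟨of e, by rw [isIdempotentElem_of, isIdempotentElem_of]⟩

theorem isRegularElem_of_mem (hP : IsSplitting P) (hx : x ∈ P) : IsRegularElem x := by
  induction x using IG.induction with
  | of e => exact isRegularElem_of e
  | mul x y ihx ihy =>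
    rcases (hP x y).1 hx with ⟨hx, h⟩ | ⟨hy, h⟩
    · exact (ihx hx).of_greenR h
    · exact (ihy hy).of_greenL h

theorem mem_of_isRegularElem (hP : IsSplitting P) (hof : ∀ e, of e ∈ P) (hx : IsRegularElem x) :
    x ∈ P := by
  obtain ⟨y, hy⟩ := hx
  have hxy : IsIdempotentElem (x * y) := by rw [IsIdempotentElem, ← mul_assoc, hy]
  refine hP.mem_of_greenR (mem_of_isIdempotentElem hP hof hxy) ((greenR _).symm ?_)
  exact greenR_mul_iff.2 ⟨x, by norm_cast; exact hy.symm⟩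

theorem isSplitting_isRegularElem : IsSplitting {x : IG S | IsRegularElem x} := by
  have hof (e : Idempotents S) : HasSeed 1 (of e) 1 := hasSeed_of.2 isSeed_one_one
  have h : {x : IG S | IsRegularElem x} = {x | HasSeed 1 x 1} := Set.ext fun x =>
    ⟨mem_of_isRegularElem isSplitting_hasSeed hof, isRegularElem_of_mem isSplitting_hasSeed⟩
  exact h ▸ isSplitting_hasSeed

end IG

end SplittingIG

section MinimalRFactorisation

variable {S : Type*} [Semigroup S] {u v w : FreeSemigroup (Idempotents S)}
  {p q : List (FreeSemigroup (Idempotents S))}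

theorem IsMinimalRFactorisation.fingerprint_eq (hp : IsMinimalRFactorisation u p)
    (hq : IsMinimalRFactorisation v q) (huv : IG.bar u = IG.bar v) :
    fingerprint (p.map IG.bar) = fingerprint (q.map IG.bar) :=
  IG.fingerprint_eq_of_bar_eq IG.isSplitting_isRegularElem IG.isRegularElem_of huv hp hq

theorem IsMinimalRFactorisation.dClasses_eq (hp : IsMinimalRFactorisation u p)
    (hq : IsMinimalRFactorisation v q) (huv : IG.bar u = IG.bar v) : dClasses p = dClasses q := by
  simpa [fingerprint, dClasses, Function.comp_def] using
    congrArg Prod.fst (hp.fingerprint_eq hq huv)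

theorem exists_isMinimalRFactorisation (w : FreeSemigroup (Idempotents S)) :
    ∃ p, IsMinimalRFactorisation w p :=
  (exists_isMinimalFactorisationIn (Q := IG.bar ⁻¹' {x | IsRegularElem x}) IG.isRegularElem_of
    w).imp fun _ => And.left

end MinimalRFactorisation

theorem theorem3_general (S : Type*) [Semigroup S] :
    (∀ (u v : FreeSemigroup (Idempotents S)) (_ : IG.bar u = IG.bar v)
      (p q : List (FreeSemigroup (Idempotents S)))
      (hp : IsMinimalRFactorisation u p) (hq : IsMinimalRFactorisation v q),
      p.length = q.length ∧
      (∀ (i : ℕ) (hi : i < p.length) (hj : i < q.length),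
        greenD (IG S) (IG.bar p[i]) (IG.bar q[i])) ∧
      greenR (IG S) (IG.bar (p.head hp.ne_nil)) (IG.bar (q.head hq.ne_nil)) ∧
      greenL (IG S) (IG.bar (p.getLast hp.ne_nil)) (IG.bar (q.getLast hq.ne_nil))) ∧
    (∀ x : IG S, ∃! F : List (Quotient (greenD (IG S))),
      ∀ (w : FreeSemigroup (Idempotents S)) (p : List (FreeSemigroup (Idempotents S))),
        IG.bar w = x → IsMinimalRFactorisation w p → dClasses p = F) := by
  refine ⟨fun u v huv p q hp hq => ?_, fun x => ?_⟩
  · have h := hp.fingerprint_eq hq huv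
    have hlen := length_eq_of_fingerprint_eq h
    have hD {i} := greenD_getElem_of_fingerprint_eq h (i := i)
    have hR := greenR_head_of_fingerprint_eq h (by simpa using hp.ne_nil) (by simpa using hq.ne_nil)
    have hL := greenL_getLast_of_fingerprint_eq h (by simpa using hp.ne_nil)
      (by simpa using hq.ne_nil)
    simp only [List.length_map, List.getElem_map, List.head_map, List.getLast_map] at hlen hD hR hL
    exact ⟨hlen, fun i hi hj => hD hi hj, hR, hL⟩
  · obtain ⟨w, rfl⟩ : ∃ w, IG.bar w = x := Quot.exists_rep x
    obtain ⟨p, hp⟩ := exists_isMinimalRFactorisation w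
    exact ⟨dClasses p, fun v q hv hq => hq.dClasses_eq hp hv, fun F hF => (hF w p rfl hp).symm⟩

theorem theorem3 (S : Type*) [Semigroup S] [Finite (Idempotents S)] :
    (∀ (u v : FreeSemigroup (Idempotents S)) (_ : IG.bar u = IG.bar v)
      (p q : List (FreeSemigroup (Idempotents S)))
      (hp : IsMinimalRFactorisation u p) (hq : IsMinimalRFactorisation v q),
      p.length = q.length ∧
      (∀ (i : ℕ) (hi : i < p.length) (hj : i < q.length),
        greenD (IG S) (IG.bar p[i]) (IG.bar q[i])) ∧
      greenR (IG S) (IG.bar (p.head hp.ne_nil)) (IG.bar (q.head hq.ne_nil)) ∧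
      greenL (IG S) (IG.bar (p.getLast hp.ne_nil)) (IG.bar (q.getLast hq.ne_nil))) ∧
    (∀ x : IG S, ∃! F : List (Quotient (greenD (IG S))),
      ∀ (w : FreeSemigroup (Idempotents S)) (p : List (FreeSemigroup (Idempotents S))),
        IG.bar w = x → IsMinimalRFactorisation w p → dClasses p = F) :=
  theorem3_general S
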